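/- Let $k,l$ be positive integers with $l<k$, and let $d=\gcd(l,k)$. Let $a\in\mathrm{GF}(2^k)$ with $a\neq 0$, and let $r\in\mathrm{GF}(2^{2k})$ with $r^{2^k+1}=1$. Regard $\mathrm{GF}(2^k)$ as a subfield of $\mathrm{GF}(2^{2k})$ and consider the polynomials over $\mathrm{GF}(2^{2k})$ \[ Q_a(x)=r^{2^l}a^{2^l}x^{2^{2l}}+x^{2^{k+l}}+rax,\qquad f(y)=y^{2^{k+l}+1}+a_1^{-2}\,y+a_1^{-2},\quad\text{where } a_1=a^{2^l}. \] Zeros are counted as distinct elements of $\mathrm{GF}(2^{2k})$. (1) If $(k+l)/d$ is even and $r^{\frac{2^k+1}{2^d+1}}=1$, then exactly one of the following holds: (i) $f$ has one zero and $Q_a$ has $2^{2d}$ zeros in $\mathrm{GF}(2^{2k})$; (ii) $f$ has two zeros and $Q_a$ has one zero in $\mathrm{GF}(2^{2k})$; (iii) $f$ has $2^{2d}+1$ zeros and $Q_a$ has $2^{4d}$ zeros in $\mathrm{GF}(2^{2k})$. (2) If $(k+l)/d$ is odd, then exactly one of the following holds: (i) $f$ has $2^d+1$ zeros and $Q_a$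 has $2^{2d}$ zeros in $\mathrm{GF}(2^{2k})$; (ii) $f$ has no zeros or two zeros, and $Q_a$ has one zero in $\mathrm{GF}(2^{2k})$. -/

import Mathlib

open Polynomial

/-- The linearized polynomial `Q_a(x) = r^{2^l} a^{2^l} x^{2^{2l}} + x^{2^{k+l}} + r a x`. -/
noncomputable def polyQ {K : Type*} [Field K] (k l : ℕ) (r a : K) : K[X] :=
  C (r ^ 2 ^ l * a ^ 2 ^ l) * X ^ 2 ^ (2 * l) + X ^ 2 ^ (k + l) + C (r * a) * X

/-- The polynomial `f(y) = y^{2^{k+l}+1} + a_1^{-2} y + a_1^{-2}`, where `a_1 = a^{2^l}`. -/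
noncomputable def polyf {K : Type*} [Field K] (k l : ℕ) (a : K) : K[X] :=
  X ^ (2 ^ (k + l) + 1) + C (((a ^ 2 ^ l) ^ 2)⁻¹) * X + C (((a ^ 2 ^ l) ^ 2)⁻¹)

/-- The number of (distinct) zeros of a polynomial in its field of coefficients. -/
noncomputable def numZeros {K : Type*} [Field K] (p : K[X]) : ℕ :=
  {x : K | p.eval x = 0}.ncard

/-- Exactly one of three propositions holds. -/
def ExactlyOneOfThree (A B D : Prop) : Prop :=
  (A ∧ ¬ B ∧ ¬ D) ∨ (¬ A ∧ B ∧ ¬ D) ∨ (¬ A ∧ ¬ B ∧ D)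

/-! Put σ = Frob^(k+l), τ = Frob^k and b = (σ a)⁻², and let q be the order of the fixed field of σ.
Since τ fixes a and inverts r, both equations can be written through σ alone. A nonzero zero x of
Q_a gives the zero y = σ(x)/(r a x) of f. The x over a given y solve σ x = (r a y) x, so they number
q - 1 if r a y is a coboundary and none otherwise; r itself is a coboundary by the hypothesis on its
order. Around a known zero y₀, setting y = y₀ + 1/w makes f affine: b σ(w) + y₀² w = y₀. If a y₀ is
not a coboundary, there is exactly one w. Otherwise the equation becomes σ t + t = c, with 0 or q
solutions. So f has 0, 1, 2 or q + 1 zeros and Q_a has 1, q, 1 or q² respectively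
(`ncard_zeros_cases`). Parity removes one case. For (k+l)/d odd, q = 2^d and τ is a power of σ; a
unique zero would make c τ-invariant, and a partial trace would then solve σ t + t = c
(`ncard_twistedZeros_ne_one`). For (k+l)/d even, q = 2^(2d) and f always has a zero: it is a stable
line of a semilinear map of the plane, found from an eigenvector or by Hilbert 90
(`twistedZeros_nonempty`). -/

/-- `u` is a multiplicative coboundary for `σ`: `u = σ x / x` for some nonzero `x`. -/
def IsMulCoboundary {K : Type*} [Field K] (σ : K →+* K) (u : K) : Prop :=
  ∃ x : K, x ≠ 0 ∧ σ x = u * x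

/-! ### Calculus of multiplicative coboundaries. -/

namespace IsMulCoboundary

variable {K : Type*} [Field K] {σ : K →+* K} {u v : K}

theorem mul (hu : IsMulCoboundary σ u) (hv : IsMulCoboundary σ v) :
    IsMulCoboundary σ (u * v) := by
  obtain ⟨x, hx, hxu⟩ := hu
  obtain ⟨y, hy, hyv⟩ := hv
  exact ⟨x * y, mul_ne_zero hx hy, by rw [map_mul, hxu, hyv]; ring⟩

theorem inv (hu : IsMulCoboundary σ u) : IsMulCoboundary σ u⁻¹ := by
  obtain ⟨x, hx, hxu⟩ := hu
  exact ⟨x⁻¹, inv_ne_zero hx, by rw [map_inv₀, hxu, mul_inv]⟩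

theorem map_div_self {x : K} (hx : x ≠ 0) : IsMulCoboundary σ (σ x / x) :=
  ⟨x, hx, by field_simp⟩

theorem mul_iff_right (hu : IsMulCoboundary σ u) (hu0 : u ≠ 0) :
    IsMulCoboundary σ (u * v) ↔ IsMulCoboundary σ v := by
  refine ⟨fun h => ?_, hu.mul⟩
  have := hu.inv.mul h
  rwa [inv_mul_cancel_left₀ hu0] at this

theorem sq_iff [Finite K] [CharP K 2] : IsMulCoboundary σ (u ^ 2) ↔ IsMulCoboundary σ u := by
  constructor
  · rintro ⟨x, hx, hxu⟩
    obtain ⟨z, rfl⟩ := FiniteField.isSquare_of_char_two (ringChar.eq K 2 ▸ rfl) x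
    refine ⟨z, left_ne_zero_of_mul hx, ?_⟩
    rw [map_mul, ← sq, ← sq, ← mul_pow] at hxu
    exact CharTwo.sq_injective hxu
  · intro h
    rw [sq]
    exact h.mul h

end IsMulCoboundary

/-! ### Solution counts for first-order equations in σ. -/

section FixedPoints

variable {K : Type*} [Field K] (σ : K →+* K)

theorem one_lt_ncard_fixed [Finite K] : 1 < {x : K | σ x = x}.ncard := by
  rw [Set.one_lt_ncard_iff]
  exact ⟨0, 1, by simp, by simp, zero_ne_one⟩

/-- The solutions of `σ t + t = c` form a translate of the fixed field, if there are any. -/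
theorem ncard_artinSchreier [CharP K 2] {c t₀ : K} (h : σ t₀ + t₀ = c) :
    {t : K | σ t + t = c}.ncard = {x : K | σ x = x}.ncard := by
  have : {t : K | σ t + t = c} = (fun x => x + t₀) '' {x : K | σ x = x} := by
    ext t
    simp only [Set.mem_ofPred_eq, Set.mem_image]
    constructor
    · intro ht
      refine ⟨t + t₀, ?_, by rw [add_assoc, CharTwo.add_self_eq_zero, add_zero]⟩
      rw [map_add, ← CharTwo.add_eq_zero]
      linear_combination ht + h + CharTwo.add_self_eq_zero c
    · rintro ⟨x, hx, rfl⟩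
      rw [map_add, hx]
      linear_combination h + CharTwo.add_self_eq_zero x
  rw [this, Set.ncard_image_of_injective _ (add_left_injective t₀)]

theorem ncard_mul_eq {x₀ u : K} (hx₀ : x₀ ≠ 0) (h : σ x₀ = u * x₀) :
    {x : K | x ≠ 0 ∧ σ x = u * x}.ncard = {x : K | σ x = x}.ncard - 1 := by
  have : {x : K | x ≠ 0 ∧ σ x = u * x} = (fun x => x * x₀) '' ({x : K | σ x = x} \ {0}) := by
    have hu : u ≠ 0 := by
      rintro rfl
      rw [zero_mul, map_eq_zero] at h
      exact hx₀ h
    ext x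
    simp only [Set.mem_ofPred_eq, Set.mem_image, Set.mem_sdiff, Set.mem_singleton_iff]
    constructor
    · rintro ⟨hx0, hx⟩
      refine ⟨x / x₀, ⟨?_, div_ne_zero hx0 hx₀⟩, by field_simp⟩
      rw [map_div₀, hx, h]
      field_simp
    · rintro ⟨x, ⟨hx, hx0⟩, rfl⟩
      refine ⟨mul_ne_zero hx0 hx₀, ?_⟩
      rw [map_mul, hx, h]
      ring
  rw [this, Set.ncard_image_of_injective _ (mul_left_injective₀ hx₀),
    Set.ncard_sdiff_singleton_of_mem (by simp)]

end FixedPoints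

/-! ### Joint zero counts over a general σ. -/

section Trichotomy

variable {K : Type*} [Field K] (σ : K →+* K)

/-- The zeros of `y σ(y) + b y + b`. -/
def twistedZeros (b : K) : Set K := {y | y * σ y + b * y + b = 0}

/-- The zeros of `σ(a r⁻¹) σ²(x) + σ(x) + r a x`. -/
def semilinearZeros (r a : K) : Set K := {x | σ (a / r) * σ (σ x) + σ x + r * a * x = 0}

variable {σ}

theorem ne_zero_of_mem_twistedZeros {b y : K} (hb : b ≠ 0) (hy : y ∈ twistedZeros σ b) :
    y ≠ 0 := by
  rintro rfl
  simp [twistedZeros, hb] at hy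

/-- Moving y₀ to infinity by y = y₀ + 1/w linearizes the equation. The extra 1 counts y₀ itself. -/
theorem ncard_twistedZeros [Finite K] [CharP K 2] {b y₀ : K} (hb : b ≠ 0) (hy₀ : y₀ ∈ twistedZeros σ b) :
    (twistedZeros σ b).ncard = {w : K | b * σ w + y₀ ^ 2 * w = y₀}.ncard + 1 := by
  have h0 := ne_zero_of_mem_twistedZeros hb hy₀
  have hy₀' : y₀ * σ y₀ + b * y₀ + b = 0 := hy₀
  have two : (2 : K) = 0 := CharTwo.two_eq_zero
  have hset : twistedZeros σ b =
      insert y₀ ((fun w => y₀ + w⁻¹) '' {w : K | b * σ w + y₀ ^ 2 * w = y₀}) := by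
    ext y
    simp only [Set.mem_insert_iff, Set.mem_image, Set.mem_ofPred_eq]
    constructor
    · intro hy
      have hy : y * σ y + b * y + b = 0 := hy
      by_cases hyy : y = y₀
      · exact Or.inl hyy
      right
      have hs : y + y₀ ≠ 0 := fun h => hyy (CharTwo.add_eq_zero.1 h)
      have hs' : σ y + σ y₀ ≠ 0 := by
        rw [← map_add]
        exact (map_ne_zero σ).2 hs
      refine ⟨(y + y₀)⁻¹, ?_, by rw [inv_inv]; linear_combination y₀ * two⟩
      rw [map_inv₀, map_add]
      field_simp
      linear_combination y₀ * hy + y * hy₀' - (y₀ * y * σ y + y₀ * y * σ y₀ + y₀ * b * y) * two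
    · rintro (rfl | ⟨w, hw, rfl⟩)
      · exact hy₀
      · have hw0 : w ≠ 0 := by
          rintro rfl
          simp at hw
          exact h0 hw.symm
        have hsw : σ w ≠ 0 := by simpa using hw0
        change (y₀ + w⁻¹) * σ (y₀ + w⁻¹) + b * (y₀ + w⁻¹) + b = 0
        rw [map_add, map_inv₀]
        field_simp
        -- The extra factor y₀ lets `hy₀'` eliminate σ y₀, which occurs there only in y₀ σ y₀.
        apply mul_left_cancel₀ h0
        linear_combination (y₀ * w * σ w) * hy₀' + σ w * hy₀' + hw + (y₀ - b * σ w) * two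
  rw [hset, Set.ncard_insert_of_notMem, Set.ncard_image_of_injective]
  · intro w w' h
    simpa using h
  · rintro ⟨w, hw, h⟩
    have : w = 0 := by simpa using h
    subst this
    simp at hw
    exact h0 hw.symm

theorem ncard_affine_of_not_isMulCoboundary [Finite K] [CharP K 2] {b y₀ : K} (hb : b ≠ 0)
    (h : ¬ IsMulCoboundary σ (y₀ ^ 2 / b)) :
    {w : K | b * σ w + y₀ ^ 2 * w = y₀}.ncard = 1 := by
  let g : K →+ K :=
    { toFun := fun w => b * σ w + y₀ ^ 2 * w
      map_zero' := by simp
      map_add' := fun x y => by rw [map_add]; ring }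
  have hg : Function.Injective g := by
    rw [injective_iff_map_eq_zero]
    intro x hx
    by_contra hx0
    refine h ⟨x, hx0, ?_⟩
    have hx : b * σ x + y₀ ^ 2 * x = 0 := hx
    field_simp
    linear_combination hx - x * y₀ ^ 2 * CharTwo.two_eq_zero (R := K)
  obtain ⟨w, hw⟩ := Finite.surjective_of_injective hg y₀
  rw [Set.ncard_eq_one]
  refine ⟨w, Set.eq_singleton_iff_unique_mem.2 ⟨hw, fun v hv => hg ?_⟩⟩
  rw [hw]
  exact hv

theorem ncard_affine_of_isMulCoboundary [CharP K 2] {b y₀ w₀ : K} (hb : b ≠ 0)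
    (hy₀ : y₀ ≠ 0) (hw₀ : w₀ ≠ 0) (h : σ w₀ = y₀ ^ 2 / b * w₀) :
    {w : K | b * σ w + y₀ ^ 2 * w = y₀}.ncard =
      {t : K | σ t + t = (y₀ * w₀)⁻¹}.ncard := by
  have : {w : K | b * σ w + y₀ ^ 2 * w = y₀} =
      (fun t => t * w₀) '' {t : K | σ t + t = (y₀ * w₀)⁻¹} := by
    ext w
    simp only [Set.mem_ofPred_eq, Set.mem_image]
    constructor
    · intro hw
      refine ⟨w / w₀, ?_, by field_simp⟩
      rw [map_div₀, h]
      field_simp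
      linear_combination hw
    · rintro ⟨t, ht, rfl⟩
      rw [map_mul, h]
      field_simp at ht ⊢
      linear_combination ht
  rw [this, Set.ncard_image_of_injective _ (mul_left_injective₀ hw₀)]

/-- The left side concerns (σ(a) y₀)². Squaring is bijective and commutes with σ, and σ(a)/a is a
coboundary. -/
theorem isMulCoboundary_sq_div_iff [Finite K] [CharP K 2] {a y₀ : K} (ha : a ≠ 0) :
    IsMulCoboundary σ (y₀ ^ 2 / ((σ a) ^ 2)⁻¹) ↔ IsMulCoboundary σ (a * y₀) := by
  have hσa : σ a ≠ 0 := (map_ne_zero σ).2 ha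
  rw [div_inv_eq_mul, ← mul_pow, IsMulCoboundary.sq_iff,
    ← (IsMulCoboundary.map_div_self (σ := σ) ha).mul_iff_right (v := a * y₀)
      (div_ne_zero hσa ha)]
  congr! 1
  field_simp

theorem ncard_twistedZeros_of_isMulCoboundary [Finite K] [CharP K 2] {a y₀ : K} (ha : a ≠ 0)
    (hy₀ : y₀ ∈ twistedZeros σ ((σ a) ^ 2)⁻¹) (h : IsMulCoboundary σ (a * y₀)) :
    (twistedZeros σ ((σ a) ^ 2)⁻¹).ncard = 1 ∨
      (twistedZeros σ ((σ a) ^ 2)⁻¹).ncard = {x : K | σ x = x}.ncard + 1 := by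
  have hb : ((σ a) ^ 2)⁻¹ ≠ 0 := inv_ne_zero (pow_ne_zero _ ((map_ne_zero σ).2 ha))
  obtain ⟨w₀, hw₀, hw⟩ := (isMulCoboundary_sq_div_iff ha).2 h
  rw [ncard_twistedZeros hb hy₀,
    ncard_affine_of_isMulCoboundary hb (ne_zero_of_mem_twistedZeros hb hy₀) hw₀ hw]
  rcases Set.eq_empty_or_nonempty {t : K | σ t + t = (y₀ * w₀)⁻¹} with h0 | ⟨t, ht⟩
  · exact Or.inl (by rw [h0, Set.ncard_empty])
  · rw [ncard_artinSchreier σ ht]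
    exact Or.inr rfl

theorem ncard_twistedZeros_of_not_isMulCoboundary [Finite K] [CharP K 2] {a y₀ : K}
    (ha : a ≠ 0) (hy₀ : y₀ ∈ twistedZeros σ ((σ a) ^ 2)⁻¹)
    (h : ¬ IsMulCoboundary σ (a * y₀)) : (twistedZeros σ ((σ a) ^ 2)⁻¹).ncard = 2 := by
  have hb : ((σ a) ^ 2)⁻¹ ≠ 0 := inv_ne_zero (pow_ne_zero _ ((map_ne_zero σ).2 ha))
  rw [ncard_twistedZeros hb hy₀, ncard_affine_of_not_isMulCoboundary hb]
  rwa [isMulCoboundary_sq_div_iff ha]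

/-- Nonzero zeros of the semilinear equation correspond, up to the fixed field, to zeros `y` of
`y σ(y) + b y + b` for which `a y` is a coboundary. -/
theorem ncard_semilinearZeros [Finite K] [CharP K 2] {r a : K} (ha : a ≠ 0) (hr0 : r ≠ 0)
    (hr : IsMulCoboundary σ r) :
    (semilinearZeros σ r a).ncard = {y ∈ twistedZeros σ ((σ a) ^ 2)⁻¹ |
      IsMulCoboundary σ (a * y)}.ncard * ({x : K | σ x = x}.ncard - 1) + 1 := by
  classical
  have := Fintype.ofFinite K
  have hσa : σ a ≠ 0 := (map_ne_zero σ).2 ha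
  have hσr : σ r ≠ 0 := (map_ne_zero σ).2 hr0
  have key : ∀ x : K, x ≠ 0 → (x ∈ semilinearZeros σ r a ↔
      σ x / (r * a * x) ∈ twistedZeros σ ((σ a) ^ 2)⁻¹) := by
    intro x hx
    have hσx : σ x ≠ 0 := (map_ne_zero σ).2 hx
    simp only [semilinearZeros, twistedZeros, Set.mem_ofPred_eq, map_div₀, map_mul]
    field_simp
    simp
  have h0 : (0 : K) ∈ semilinearZeros σ r a := by simp [semilinearZeros]
  rw [← Set.ncard_sdiff_singleton_add_one h0]
  congr 1
  set S := semilinearZeros σ r a \ {0}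
  set T := {y ∈ twistedZeros σ ((σ a) ^ 2)⁻¹ | IsMulCoboundary σ (a * y)}
  rw [Set.ncard_eq_toFinset_card' S, Set.ncard_eq_toFinset_card' T]
  have hmaps : ∀ x ∈ S.toFinset, σ x / (r * a * x) ∈ T.toFinset := by
    intro x hx
    rw [Set.mem_toFinset] at hx ⊢
    have hx0 : x ≠ 0 := hx.2
    refine ⟨(key x hx0).1 hx.1, ?_⟩
    rw [← hr.mul_iff_right hr0]
    refine ⟨x, hx0, ?_⟩
    field_simp
  rw [Finset.card_eq_sum_card_fiberwise hmaps]
  refine Finset.sum_const_nat fun y hy => ?_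
  rw [Set.mem_toFinset] at hy
  have hy0 : y ≠ 0 :=
    ne_zero_of_mem_twistedZeros (inv_ne_zero (pow_ne_zero _ hσa)) hy.1
  obtain ⟨x₀, hx₀, hx₀y⟩ := hr.mul hy.2
  rw [← ncard_mul_eq σ hx₀ hx₀y, ← Set.ncard_coe_finset]
  congr 1
  ext x
  simp only [Finset.coe_filter, Set.mem_toFinset, Set.mem_ofPred_eq]
  constructor
  · rintro ⟨⟨-, hx⟩, rfl⟩
    have hx0 : x ≠ 0 := hx
    refine ⟨hx0, ?_⟩
    field_simp
  · rintro ⟨hx0, hx⟩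
    have hxy : σ x / (r * a * x) = y := by
      rw [hx]
      field_simp
    exact ⟨⟨(key x hx0).2 (hxy ▸ hy.1), hx0⟩, hxy⟩

/-- The joint possibilities for the numbers of zeros of the two equations. -/
theorem ncard_zeros_cases [Finite K] [CharP K 2] {r a : K} (ha : a ≠ 0) (hr0 : r ≠ 0)
    (hr : IsMulCoboundary σ r) {q : ℕ} (hq : {x : K | σ x = x}.ncard = q) :
    ((twistedZeros σ ((σ a) ^ 2)⁻¹).ncard = 0 ∧ (semilinearZeros σ r a).ncard = 1) ∨
    ((twistedZeros σ ((σ a) ^ 2)⁻¹).ncard = 1 ∧ (semilinearZeros σ r a).ncard = q) ∨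
    ((twistedZeros σ ((σ a) ^ 2)⁻¹).ncard = 2 ∧ (semilinearZeros σ r a).ncard = 1) ∨
    ((twistedZeros σ ((σ a) ^ 2)⁻¹).ncard = q + 1 ∧
      (semilinearZeros σ r a).ncard = q ^ 2) := by
  have hq1 : 1 < q := hq ▸ one_lt_ncard_fixed σ
  have hcount := ncard_semilinearZeros ha hr0 hr
  rw [hq] at hcount
  by_cases hex : ∃ y ∈ twistedZeros σ ((σ a) ^ 2)⁻¹, IsMulCoboundary σ (a * y)
  · obtain ⟨y, hy, hya⟩ := hex
    have h1 := ncard_twistedZeros_of_isMulCoboundary ha hy hya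
    -- One zero of coboundary type forces all to be: the total is 1 or q + 1, whereas any zero of
    -- the other type would make it 2, and q > 1.
    have hT : {y ∈ twistedZeros σ ((σ a) ^ 2)⁻¹ | IsMulCoboundary σ (a * y)} =
        twistedZeros σ ((σ a) ^ 2)⁻¹ := by
      refine Set.sep_eq_self_iff_mem_true.2 fun z hz => ?_
      by_contra hza
      have := ncard_twistedZeros_of_not_isMulCoboundary ha hz hza
      omega
    rw [hT] at hcount
    obtain ⟨q, rfl⟩ : ∃ p, q = p + 1 := ⟨q - 1, by omega⟩
    rw [hq] at h1
    rcases h1 with h1 | h1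
    · right; left
      rw [h1] at hcount
      exact ⟨h1, by rw [hcount]; simp⟩
    · right; right; right
      rw [h1] at hcount
      exact ⟨h1, by rw [hcount, Nat.add_sub_cancel]; ring⟩
  · push Not at hex
    have hT : {y ∈ twistedZeros σ ((σ a) ^ 2)⁻¹ | IsMulCoboundary σ (a * y)} = ∅ :=
      Set.eq_empty_of_forall_notMem fun z hz => hex z hz.1 hz.2
    rw [hT, Set.ncard_empty, zero_mul, zero_add] at hcount
    rcases Set.eq_empty_or_nonempty (twistedZeros σ ((σ a) ^ 2)⁻¹) with h0 | ⟨y, hy⟩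
    · exact Or.inl ⟨by rw [h0, Set.ncard_empty], hcount⟩
    · exact Or.inr (Or.inr (Or.inl
        ⟨ncard_twistedZeros_of_not_isMulCoboundary ha hy (hex y hy), hcount⟩))

end Trichotomy
-- Powers in cyclic groups and fixed fields of Frobenius powers.
section FiniteFieldPowers

/-- With g = gcd(|G|, N), the N-th powers lie in the kernel of the (|G|/g)-th power map, and the
orders agree. -/
theorem IsCyclic.exists_pow_eq_of_pow_eq_one {G : Type*} [CommGroup G] [IsCyclic G] [Finite G]
    {u : G} {M N : ℕ} (hu : u ^ M = 1) (h : (Nat.card G).gcd N * M ∣ Nat.card G) :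
    ∃ x : G, x ^ N = u := by
  set g := (Nat.card G).gcd N with hg
  have hg0 : 0 < g := Nat.gcd_pos_of_pos_left _ Nat.card_pos
  obtain ⟨c, hc⟩ : g ∣ Nat.card G := Nat.gcd_dvd_left _ _
  have hdiv : Nat.card G / g = c := by rw [hc, Nat.mul_div_cancel_left _ hg0]
  have hle : (powMonoidHom N : G →* G).range ≤ (powMonoidHom c : G →* G).ker := by
    rintro _ ⟨x, rfl⟩
    rw [MonoidHom.mem_ker, powMonoidHom_apply, powMonoidHom_apply, ← pow_mul]
    obtain ⟨e, he⟩ : g ∣ N := Nat.gcd_dvd_right _ _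
    have : N * c = Nat.card G * e := by rw [hc, he]; ring
    rw [this, pow_mul, pow_card_eq_one', one_pow]
  have heq : (powMonoidHom N : G →* G).range = (powMonoidHom c : G →* G).ker := by
    refine Subgroup.eq_of_le_of_card_ge hle ?_
    rw [IsCyclic.card_powMonoidHom_range, IsCyclic.card_powMonoidHom_ker, ← hg, hdiv]
    exact Nat.gcd_le_right _ (Nat.pos_of_ne_zero fun h0 =>
      Nat.card_pos.ne' (by rw [hc, h0, mul_zero] : Nat.card G = 0))
  have hmem : u ∈ (powMonoidHom c : G →* G).ker := by
    rw [MonoidHom.mem_ker, powMonoidHom_apply]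
    have hMc : M ∣ c := by
      rw [hc] at h
      exact Nat.dvd_of_mul_dvd_mul_left hg0 h
    obtain ⟨e, rfl⟩ := hMc
    rw [pow_mul, hu, one_pow]
  rw [← heq] at hmem
  exact hmem

variable {K : Type*} [Field K] [Finite K]

theorem ncard_pow_two_pow_eq_self {n : ℕ} (hK : Nat.card K = 2 ^ n) (j : ℕ) :
    {x : K | x ^ 2 ^ j = x}.ncard = 2 ^ j.gcd n := by
  have hset : {x : K | x ^ 2 ^ j = x} = insert 0
      ((fun u : Kˣ => (u : K)) '' ((powMonoidHom (2 ^ j - 1) : Kˣ →* Kˣ).ker : Set Kˣ)) := by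
    have hj : 2 ^ j = 2 ^ j - 1 + 1 := (Nat.sub_add_cancel Nat.one_le_two_pow).symm
    ext x
    simp only [Set.mem_ofPred_eq, Set.mem_insert_iff, Set.mem_image, SetLike.mem_coe,
      MonoidHom.mem_ker, powMonoidHom_apply]
    constructor
    · intro hx
      by_cases hx0 : x = 0
      · exact Or.inl hx0
      refine Or.inr ⟨Units.mk0 x hx0, ?_, rfl⟩
      rw [hj, pow_succ] at hx
      ext
      rw [Units.val_pow_eq_pow_val, Units.val_mk0, Units.val_one]
      exact mul_right_cancel₀ hx0 (by rw [hx, one_mul])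
    · rintro (rfl | ⟨u, hu, rfl⟩)
      · exact zero_pow (by positivity)
      · rw [hj, pow_succ, ← Units.val_pow_eq_pow_val, hu, Units.val_one, one_mul]
  rw [hset, Set.ncard_insert_of_notMem, Set.ncard_image_of_injective _ Units.val_injective]
  · have : ((powMonoidHom (2 ^ j - 1) : Kˣ →* Kˣ).ker : Set Kˣ).ncard =
        Nat.card (powMonoidHom (2 ^ j - 1) : Kˣ →* Kˣ).ker := rfl
    rw [this, IsCyclic.card_powMonoidHom_ker, Nat.card_units, hK,
      Nat.pow_sub_one_gcd_pow_sub_one, Nat.gcd_comm,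
      Nat.sub_add_cancel Nat.one_le_two_pow]
  · rintro ⟨u, -, hu⟩
    exact u.ne_zero hu

/-- Coboundaries of Frob^s are the nonzero (2^s - 1)-th powers. -/
theorem isMulCoboundary_iterateFrobenius [CharP K 2] {n s M : ℕ} (hK : Nat.card K = 2 ^ n)
    {u : K} (hu0 : u ≠ 0) (hu : u ^ M = 1) (h : (2 ^ s.gcd n - 1) * M ∣ 2 ^ n - 1) :
    IsMulCoboundary (iterateFrobenius K 2 s) u := by
  have hu' : (Units.mk0 u hu0) ^ M = 1 := by
    ext
    simpa using hu
  obtain ⟨x, hx⟩ := IsCyclic.exists_pow_eq_of_pow_eq_one (N := 2 ^ s - 1) hu' (by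
    rwa [Nat.card_units, hK, Nat.pow_sub_one_gcd_pow_sub_one, Nat.gcd_comm])
  refine ⟨x, x.ne_zero, ?_⟩
  have hx' : (x : K) ^ (2 ^ s - 1) = u := by
    rw [← Units.val_pow_eq_pow_val, hx, Units.val_mk0]
  rw [iterateFrobenius_def, ← hx', ← pow_succ, Nat.sub_add_cancel Nat.one_le_two_pow]

end FiniteFieldPowers

/-! ### Excluding a single zero when τ is a power of σ. -/

section ConjugationInvariance

variable {K : Type*} [Field K] [CharP K 2]

/-- The partial trace of `g` solves `φ t + t = φ ^ j g + g`. -/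
theorem sum_iterate_artinSchreier (φ : K →+* K) (j : ℕ) (g : K) :
    φ (∑ i ∈ Finset.range j, φ^[i] g) + ∑ i ∈ Finset.range j, φ^[i] g = φ^[j] g + g := by
  induction j with
  | zero => simp [CharTwo.add_self_eq_zero]
  | succ j ih =>
    rw [Finset.sum_range_succ, map_add, ← Function.iterate_succ_apply' φ]
    linear_combination ih + CharTwo.add_self_eq_zero (φ^[j] g)

theorem exists_add_eq_of_fixed {τ : K →+* K} (hτ : ∀ x, τ (τ x) = x) {θ c : K}
    (hθ : τ θ ≠ θ) (hc : τ c = c) :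
    τ (c * θ / (τ θ + θ)) + c * θ / (τ θ + θ) = c := by
  have h : τ θ + θ ≠ 0 := fun h => hθ (CharTwo.add_eq_zero.1 h)
  have h' : θ + τ θ ≠ 0 := by rwa [add_comm]
  rw [map_div₀, map_mul, hc, map_add, hτ]
  field_simp
  ring

/-- If an involution `τ` fixing `a` is a power of `σ`, then `y σ(y) + b y + b` does not have
exactly one zero. -/
theorem ncard_twistedZeros_ne_one [Finite K] {σ τ : K →+* K} {j : ℕ}
    (hτ : ∀ x, τ (τ x) = x)
    (hστ : ∀ x, σ^[j] x = τ x) {θ : K} (hθ : τ θ ≠ θ) {a : K} (ha : a ≠ 0) (haτ : τ a = a) :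
    (twistedZeros σ ((σ a) ^ 2)⁻¹).ncard ≠ 1 := by
  intro h1
  have hb : ((σ a) ^ 2)⁻¹ ≠ 0 := inv_ne_zero (pow_ne_zero _ ((map_ne_zero σ).2 ha))
  have hcomm : ∀ x, τ (σ x) = σ (τ x) := fun x => by
    rw [← hστ, ← hστ, ← Function.iterate_succ_apply, Function.iterate_succ_apply']
  obtain ⟨y, hy⟩ := Set.ncard_eq_one.1 h1
  have hymem : y ∈ twistedZeros σ ((σ a) ^ 2)⁻¹ := hy ▸ Set.mem_singleton y
  have hyτ : τ y = y := by
    have : τ y ∈ twistedZeros σ ((σ a) ^ 2)⁻¹ := by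
      have h : y * σ y + ((σ a) ^ 2)⁻¹ * y + ((σ a) ^ 2)⁻¹ = 0 := hymem
      have h := congrArg τ h
      simp only [map_add, map_mul, map_inv₀, map_pow, hcomm, haτ, map_zero] at h
      exact h
    rwa [hy] at this
  have hy0 := ne_zero_of_mem_twistedZeros hb hymem
  have hcob : IsMulCoboundary σ (y ^ 2 / ((σ a) ^ 2)⁻¹) := by
    by_contra h
    rw [isMulCoboundary_sq_div_iff ha] at h
    rw [ncard_twistedZeros_of_not_isMulCoboundary ha hymem h] at h1
    omega
  obtain ⟨w, hw0, hw⟩ := hcob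
  rw [ncard_twistedZeros hb hymem, ncard_affine_of_isMulCoboundary hb hy0 hw0 hw] at h1
  have hwτ : τ w = w := by
    -- The ratio τ(w)/w is σ-fixed, hence τ-fixed; but τ inverts it, so its square is 1 and it
    -- equals 1 in characteristic 2.
    have hfix : σ (τ w / w) = τ w / w := by
      have hu : y ^ 2 / ((σ a) ^ 2)⁻¹ ≠ 0 := div_ne_zero (pow_ne_zero _ hy0) hb
      rw [map_div₀, ← hcomm, hw, map_mul]
      have : τ (y ^ 2 / ((σ a) ^ 2)⁻¹) = y ^ 2 / ((σ a) ^ 2)⁻¹ := by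
        simp only [map_div₀, map_inv₀, map_pow, hcomm, haτ, hyτ]
      rw [this, mul_div_mul_left _ _ hu]
    have hfixτ : τ (τ w / w) = τ w / w := by
      rw [← hστ]
      exact Function.IsFixedPt.iterate hfix j
    have hτw : τ w ≠ 0 := (map_ne_zero τ).2 hw0
    rw [map_div₀, hτ] at hfixτ
    field_simp at hfixτ
    exact (CharTwo.sq_injective hfixτ).symm
  have hc : τ (y * w)⁻¹ = (y * w)⁻¹ := by rw [map_inv₀, map_mul, hyτ, hwτ]
  have hne : {t : K | σ t + t = (y * w)⁻¹}.Nonempty := by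
    refine ⟨_, (sum_iterate_artinSchreier σ j ((y * w)⁻¹ * θ / (τ θ + θ))).trans ?_⟩
    rw [hστ]
    exact exists_add_eq_of_fixed hτ hθ hc
  have := (Set.ncard_pos).2 hne
  omega

end ConjugationInvariance
-- Existence of a zero through 2 × 2 matrix cocycles.
section Cocycle

variable {K : Type*} [Field K]

/-- The products `σ^(i-1)(B) ⋯ σ(B) B`. -/
def twistedPow (σ : K →+* K) (B : Matrix (Fin 2) (Fin 2) K) : ℕ → Matrix (Fin 2) (Fin 2) K
  | 0 => 1
  | i + 1 => σ.mapMatrix (twistedPow σ B i) * B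

variable {σ : K →+* K} {B : Matrix (Fin 2) (Fin 2) K}

theorem twistedPow_succ' (i : ℕ) :
    twistedPow σ B (i + 1) = (σ.mapMatrix)^[i] B * twistedPow σ B i := by
  induction i with
  | zero => simp [twistedPow]
  | succ i ih =>
    rw [twistedPow]
    conv_lhs => rw [ih, map_mul, ← Function.iterate_succ_apply' σ.mapMatrix, Matrix.mul_assoc]
    rfl

theorem map_twistedPow_mul {m : ℕ} (hσ : ∀ x, σ^[m] x = x) :
    σ.mapMatrix (twistedPow σ B m) * B = B * twistedPow σ B m := by
  have h : (σ.mapMatrix)^[m] B = B := by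
    have : ∀ i, ∀ C : Matrix (Fin 2) (Fin 2) K, (σ.mapMatrix)^[i] C = C.map (σ^[i]) := by
      intro i
      induction i with
      | zero => intro C; ext; rfl
      | succ i ih => intro C; rw [Function.iterate_succ_apply, ih]; ext; rfl
    rw [this]
    ext
    simp [hσ]
  have h' := twistedPow_succ' (σ := σ) (B := B) m
  rwa [h] at h'

theorem det_twistedPow (hB : B.det = 1) (i : ℕ) : (twistedPow σ B i).det = 1 := by
  induction i with
  | zero => simp [twistedPow]
  | succ i ih => rw [twistedPow, Matrix.det_mul, hB, ← RingHom.map_det, ih, map_one, mul_one]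

theorem map_twistedPow {τ : K →+* K} (hcomm : ∀ x, τ (σ x) = σ (τ x))
    (hB : τ.mapMatrix B = B) (i : ℕ) : τ.mapMatrix (twistedPow σ B i) = twistedPow σ B i := by
  induction i with
  | zero => simp [twistedPow]
  | succ i ih =>
    rw [twistedPow, map_mul, hB]
    congr 1
    conv_rhs => rw [← ih]
    ext
    simp [hcomm]

/-- When σ^m = 1, σ(A) = B A B⁻¹ for A the full twisted product. -/
theorem map_trace_twistedPow (hB : B.det = 1) {m : ℕ} (hσ : ∀ x, σ^[m] x = x) :
    σ (twistedPow σ B m).trace = (twistedPow σ B m).trace := by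
  have hBB : B * B.adjugate = 1 := by rw [Matrix.mul_adjugate, hB, one_smul]
  have h := congrArg (fun C => (C * B.adjugate).trace) (map_twistedPow_mul (B := B) hσ)
  simp only [Matrix.mul_assoc, hBB, Matrix.mul_one] at h
  rw [Matrix.trace_mul_comm, Matrix.mul_assoc, Matrix.adjugate_mul, hB, one_smul,
    Matrix.mul_one] at h
  refine Eq.trans ?_ h
  simp [Matrix.trace]

/-- A form of Hilbert 90 for `2 × 2` matrices. -/
theorem exists_map_eq_mulVec (hB : B.det = 1) {m : ℕ} (hm : 0 < m)
    (hσ : ∀ x, σ^[m] x = x) (hinj : ∀ i < m, ∀ j < m, σ^[i] = σ^[j] → i = j)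
    (hA : twistedPow σ B m = 1) :
    ∃ v : Fin 2 → K, v ≠ 0 ∧ (fun i => σ (v i)) = B.mulVec v := by
  -- Terms of a Poincaré series: σ sends term i to B times term i + 1, and the terms repeat with
  -- period m. The adjugate is the inverse, as the determinant is 1.
  let P : K → ℕ → Fin 2 → K := fun c i =>
    (twistedPow σ B i).adjugate.mulVec ![σ^[i] c, 0]
  have hP : ∀ c i, (fun j => σ (P c i j)) = B.mulVec (P c (i + 1)) := by
    intro c i
    have h1 : B * (twistedPow σ B (i + 1)).adjugate =
        (σ.mapMatrix (twistedPow σ B i)).adjugate := by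
      rw [twistedPow, Matrix.adjugate_mul_distrib, ← Matrix.mul_assoc, Matrix.mul_adjugate, hB,
        one_smul, Matrix.one_mul]
    simp only [P]
    rw [Matrix.mulVec_mulVec, h1, ← RingHom.map_adjugate]
    ext j
    rw [RingHom.map_mulVec]
    congr 2
    ext j'
    fin_cases j' <;> simp [Function.iterate_succ_apply']
  have hPm : ∀ c, P c m = P c 0 := by
    intro c
    simp only [P, hA, hσ]
    simp [twistedPow]
  -- Dedekind independence of the powers of σ; the coefficient at i = 0 is 1.
  obtain ⟨c, hc⟩ : ∃ c, (∑ i ∈ Finset.range m, P c i) 0 ≠ 0 := by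
    by_contra! hcon
    let f : Fin m → (K →* K) := fun i => ((σ ^ (i : ℕ) : K →+* K) : K →* K)
    have hf : ∀ i c, f i c = σ^[i] c := fun i c => by
      simp [f, RingHom.coe_pow]
    have hfinj : Function.Injective f := by
      intro i j hij
      refine Fin.ext (hinj i i.2 j j.2 ?_)
      funext c
      rw [← hf, ← hf, hij]
    have hli := (linearIndependent_monoidHom K K).comp f hfinj
    rw [Fintype.linearIndependent_iff] at hli
    have h0 := hli (fun i => (twistedPow σ B i) 1 1) (by
      funext c
      have h := hcon c
      rw [Finset.sum_apply, Finset.sum_range] at h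
      rw [Finset.sum_apply]
      refine Eq.trans (Finset.sum_congr rfl fun i _ => ?_) h
      simp [P, hf, Matrix.adjugate_fin_two, mul_comm]) ⟨0, hm⟩
    simp [twistedPow] at h0
  refine ⟨∑ i ∈ Finset.range m, P c i, fun h => hc (by rw [h]; rfl), ?_⟩
  have hshift : ∑ i ∈ Finset.range m, P c i = ∑ i ∈ Finset.range m, P c (i + 1) := by
    have h1 := Finset.sum_range_succ (P c) m
    rw [Finset.sum_range_succ', hPm] at h1
    exact (add_right_cancel h1).symm
  conv_rhs => rw [hshift, Matrix.mulVec_sum]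
  funext j
  rw [Finset.sum_apply, Finset.sum_apply, map_sum]
  exact Finset.sum_congr rfl fun i _ => congrFun (hP c i) j

theorem exists_eq_smul_of_mul_sub_mul_eq_zero {w u : Fin 2 → K} (hu : u ≠ 0)
    (h : w 0 * u 1 - w 1 * u 0 = 0) : ∃ μ : K, w = μ • u := by
  by_cases h0 : u 0 = 0
  · have h1 : u 1 ≠ 0 := fun h1 => hu (by ext i; fin_cases i <;> simp [h0, h1])
    rw [h0, mul_zero, sub_zero] at h
    have hw := (mul_eq_zero.1 h).resolve_right h1
    exact ⟨w 1 / u 1, by ext i; fin_cases i <;> simp [h0, h1, hw]⟩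
  · refine ⟨w 0 / u 0, ?_⟩
    ext i
    fin_cases i
    · simp [h0]
    · simp only [Fin.mk_one, Pi.smul_apply, smul_eq_mul]
      field_simp
      linear_combination -h

/-- A stable line for the semilinear map attached to `B`, from an eigenvalue of `twistedPow`. -/
theorem exists_map_eq_smul_mulVec [CharP K 2] (hB : B.det = 1) {m : ℕ} (hm : 0 < m)
    (hσ : ∀ x, σ^[m] x = x) (hinj : ∀ i < m, ∀ j < m, σ^[i] = σ^[j] → i = j) {lam : K}
    (hlam : σ lam = lam) (hroot : lam ^ 2 + (twistedPow σ B m).trace * lam + 1 = 0) :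
    ∃ (v : Fin 2 → K) (μ : K), v ≠ 0 ∧ (fun i => σ (v i)) = μ • B.mulVec v := by
  have hdet := det_twistedPow (σ := σ) hB m
  have hcommA := map_twistedPow_mul (B := B) hσ
  by_cases hA1 : twistedPow σ B m = 1
  · obtain ⟨v, hv, h⟩ := exists_map_eq_mulVec hB hm hσ hinj hA1
    exact ⟨v, 1, hv, by rw [h, one_smul]⟩
  set A := twistedPow σ B m
  have hsing : (A - Matrix.diagonal fun _ => lam).det = 0 := by
    rw [Matrix.det_fin_two] at hdet ⊢
    rw [Matrix.trace_fin_two] at hroot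
    simp only [Matrix.sub_apply, Matrix.diagonal_apply_eq, Matrix.diagonal_apply_ne _ zero_ne_one,
      Matrix.diagonal_apply_ne _ one_ne_zero, sub_zero]
    linear_combination hroot + hdet - lam * (A 0 0 + A 1 1) * CharTwo.two_eq_zero (R := K)
  obtain ⟨v, hv, hAv⟩ := Matrix.exists_mulVec_eq_zero_iff.2 hsing
  have hAv : A.mulVec v = lam • v := by
    rw [Matrix.sub_mulVec, sub_eq_zero] at hAv
    rw [hAv]
    ext i
    simp [Matrix.mulVec_diagonal]
  set w : Fin 2 → K := fun i => σ (v i) with hw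
  set u := B.mulVec v with hu
  have hu0 : u ≠ 0 := by
    intro h0
    exact hv (Matrix.eq_zero_of_mulVec_eq_zero (hB ▸ one_ne_zero) h0)
  have hAw : (σ.mapMatrix A).mulVec w = lam • w := by
    ext i
    have := RingHom.map_mulVec σ A v i
    rw [hAv] at this
    simpa [hlam] using this.symm
  have hAu : (σ.mapMatrix A).mulVec u = lam • u := by
    rw [hu, Matrix.mulVec_mulVec, hcommA, ← Matrix.mulVec_mulVec, hAv, Matrix.mulVec_smul]
  refine ⟨v, ?_⟩
  -- Both σ(v) and B v are eigenvectors of σ(A) for `lam`. If they were independent, A would be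
  -- scalar of determinant 1, hence the identity.
  by_cases hprop : w 0 * u 1 - w 1 * u 0 = 0
  · obtain ⟨μ, hμ⟩ := exists_eq_smul_of_mul_sub_mul_eq_zero hu0 hprop
    exact ⟨μ, hv, hμ⟩
  · exfalso
    have e : ∀ i, (σ.mapMatrix A) i 0 * w 0 + (σ.mapMatrix A) i 1 * w 1 = lam * w i := by
      intro i
      have := congrFun hAw i
      simpa [Matrix.mulVec, dotProduct, Fin.sum_univ_two] using this
    have e' : ∀ i, (σ.mapMatrix A) i 0 * u 0 + (σ.mapMatrix A) i 1 * u 1 = lam * u i := by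
      intro i
      have := congrFun hAu i
      simpa [Matrix.mulVec, dotProduct, Fin.sum_univ_two] using this
    have a00 : σ (A 0 0) = σ lam := by
      have : ((σ.mapMatrix A) 0 0 - lam) * (w 0 * u 1 - w 1 * u 0) = 0 := by
        linear_combination u 1 * e 0 - w 1 * e' 0
      rw [hlam]
      exact sub_eq_zero.1 ((mul_eq_zero.1 this).resolve_right hprop)
    have a01 : σ (A 0 1) = 0 := by
      have : ((σ.mapMatrix A) 0 1) * (w 0 * u 1 - w 1 * u 0) = 0 := by
        linear_combination -u 0 * e 0 + w 0 * e' 0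
      exact (mul_eq_zero.1 this).resolve_right hprop
    have a10 : σ (A 1 0) = 0 := by
      have : ((σ.mapMatrix A) 1 0) * (w 0 * u 1 - w 1 * u 0) = 0 := by
        linear_combination u 1 * e 1 - w 1 * e' 1
      exact (mul_eq_zero.1 this).resolve_right hprop
    have a11 : σ (A 1 1) = σ lam := by
      have : ((σ.mapMatrix A) 1 1 - lam) * (w 0 * u 1 - w 1 * u 0) = 0 := by
        linear_combination -u 0 * e 1 + w 0 * e' 1
      rw [hlam]
      exact sub_eq_zero.1 ((mul_eq_zero.1 this).resolve_right hprop)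
    rw [map_eq_zero] at a01 a10
    have a00 := σ.injective a00
    have a11 := σ.injective a11
    rw [Matrix.det_fin_two, a00, a11, a01, a10, mul_zero, sub_zero, ← sq] at hdet
    have hl1 : lam = 1 := CharTwo.sq_injective (by simpa using hdet)
    apply hA1
    ext i j
    fin_cases i <;> fin_cases j <;> simp [a00, a01, a10, a11, hl1]

/-- Substituting `lam` = t S leaves S² + S = t⁻². If τ g + g = t⁻², the partial trace S = g + g² + ⋯
+ g^(2^(k-1)) solves it; building g from the σ-fixed θ keeps S σ-fixed. -/
theorem exists_fixed_root [CharP K 2] {τ : K →+* K} {k : ℕ}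
    (hτ : ∀ x, τ (τ x) = x) (hk : ∀ x, (frobenius K 2)^[k] x = τ x) {θ : K}
    (hσθ : σ θ = θ) (hθ : τ θ ≠ θ) {t : K} (ht : σ t = t) (htτ : τ t = t) :
    ∃ lam : K, σ lam = lam ∧ lam ^ 2 + t * lam + 1 = 0 := by
  by_cases ht0 : t = 0
  · exact ⟨1, map_one σ, by rw [ht0]; linear_combination CharTwo.two_eq_zero (R := K)⟩
  set c : K := (t ^ 2)⁻¹ with hc
  set g : K := c * θ / (τ θ + θ) with hg
  have hτσθ : σ (τ θ) = τ θ := by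
    rw [← hk, RingHom.map_iterate_frobenius, hσθ]
  have hσg : σ g = g := by
    simp only [hg, hc, map_div₀, map_mul, map_inv₀, map_pow, map_add, ht, hσθ, hτσθ]
  have hcτ : τ c = c := by simp only [hc, map_inv₀, map_pow, htτ]
  have hS := sum_iterate_artinSchreier (frobenius K 2) k g
  rw [hk, exists_add_eq_of_fixed hτ hθ hcτ, frobenius_def] at hS
  set S := ∑ i ∈ Finset.range k, (frobenius K 2)^[i] g
  have hσS : σ S = S := by
    simp only [S, map_sum, RingHom.map_iterate_frobenius, hσg]
  refine ⟨t * S, by rw [map_mul, ht, hσS], ?_⟩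
  have : t ^ 2 * (S ^ 2 + S) = 1 := by
    rw [hS, hc]
    field_simp
  linear_combination this + CharTwo.two_eq_zero (R := K)

theorem twistedZeros_nonempty [CharP K 2] {τ : K →+* K} {k m : ℕ} (hm : 0 < m)
    (hσ : ∀ x, σ^[m] x = x) (hinj : ∀ i < m, ∀ j < m, σ^[i] = σ^[j] → i = j)
    (hτ : ∀ x, τ (τ x) = x) (hk : ∀ x, (frobenius K 2)^[k] x = τ x) {θ : K}
    (hσθ : σ θ = θ) (hθ : τ θ ≠ θ) {a : K} (ha : a ≠ 0) (haτ : τ a = a) :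
    (twistedZeros σ ((σ a) ^ 2)⁻¹).Nonempty := by
  have hσa : σ a ≠ 0 := (map_ne_zero σ).2 ha
  have hcomm : ∀ x, τ (σ x) = σ (τ x) := fun x => by
    rw [← hk, ← hk, RingHom.map_iterate_frobenius]
  -- On the projective line B acts as y ↦ b (y + 1)/y, so a line with σ(v) ∝ B v has slope y = v₀/v₁
  -- satisfying y σ(y) = b (y + 1).
  set B : Matrix (Fin 2) (Fin 2) K := !![(σ a)⁻¹, (σ a)⁻¹; σ a, 0] with hBdef
  have hB : B.det = 1 := by
    rw [hBdef, Matrix.det_fin_two_of]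
    field_simp
    linear_combination -σ a * CharTwo.two_eq_zero (R := K)
  have hBτ : τ.mapMatrix B = B := by
    ext i j
    fin_cases i <;> fin_cases j <;> simp [hBdef, hcomm, haτ]
  have htτ : τ (twistedPow σ B m).trace = (twistedPow σ B m).trace := by
    conv_rhs => rw [← map_twistedPow hcomm hBτ m]
    simp [Matrix.trace]
  obtain ⟨lam, hlam, hroot⟩ :=
    exists_fixed_root hτ hk hσθ hθ (map_trace_twistedPow hB hσ) htτ
  obtain ⟨v, μ, hv, h⟩ := exists_map_eq_smul_mulVec hB hm hσ hinj hlam hroot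
  have e0 : σ (v 0) = μ * ((σ a)⁻¹ * v 0 + (σ a)⁻¹ * v 1) := by
    have := congrFun h 0
    simpa [hBdef, Matrix.mulVec, dotProduct, Fin.sum_univ_two] using this
  have e1 : σ (v 1) = μ * (σ a * v 0) := by
    have := congrFun h 1
    simpa [hBdef, Matrix.mulVec, dotProduct, Fin.sum_univ_two] using this
  have hv0 : v 0 ≠ 0 := by
    intro h0
    rw [h0, mul_zero, mul_zero, map_eq_zero] at e1
    exact hv (by ext i; fin_cases i <;> simp [h0, e1])
  have hμ : μ ≠ 0 := by
    rintro rfl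
    rw [zero_mul, map_eq_zero] at e0
    exact hv0 e0
  have hσv1 : σ (v 1) ≠ 0 := e1 ▸ mul_ne_zero hμ (mul_ne_zero hσa hv0)
  have hv1 : v 1 ≠ 0 := (map_ne_zero σ).1 hσv1
  refine ⟨v 0 / v 1, ?_⟩
  change v 0 / v 1 * σ (v 0 / v 1) + ((σ a) ^ 2)⁻¹ * (v 0 / v 1) + ((σ a) ^ 2)⁻¹ = 0
  rw [map_div₀, e0, e1]
  field_simp
  linear_combination (v 0 + v 1) * CharTwo.two_eq_zero (R := K)

end Cocycle

/-! ### From the polynomials to σ. -/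

theorem charP_two_of_card {K : Type*} [Field K] {n : ℕ} (hn : 0 < n)
    (hK : Nat.card K = 2 ^ n) : CharP K 2 := by
  have : Finite K := Nat.finite_of_card_ne_zero (by rw [hK]; positivity)
  have := Fintype.ofFinite K
  have h := Nat.cast_card_eq_zero K
  rw [← Nat.card_eq_fintype_card, hK, Nat.cast_pow, Nat.cast_ofNat] at h
  have h2 : (2 : K) = 0 := (pow_eq_zero_iff hn.ne').1 h
  exact CharTwo.of_one_ne_zero_of_two_eq_zero one_ne_zero h2

section
variable {K : Type*} [Field K] {k l : ℕ}

theorem iterateFrobenius_iterate [CharP K 2] (s i : ℕ) (x : K) :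
    (iterateFrobenius K 2 s)^[i] x = x ^ 2 ^ (s * i) := by
  rw [coe_iterateFrobenius, ← Function.iterate_mul, iterate_frobenius]

theorem pow_two_pow_mul_card [Finite K] {n : ℕ} (hK : Nat.card K = 2 ^ n) (i : ℕ) (x : K) :
    x ^ 2 ^ (n * i) = x := by
  have := Fintype.ofFinite K
  rw [pow_mul, ← hK, Nat.card_eq_fintype_card, FiniteField.pow_card_pow]

theorem dvd_mul_of_iterate_iterateFrobenius_eq [Finite K] [CharP K 2] {n s i t : ℕ}
    (hK : Nat.card K = 2 ^ n)
    (h : (iterateFrobenius K 2 s)^[i] = (iterateFrobenius K 2 s)^[i + t]) : n ∣ s * t := by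
  have huniv : {x : K | x ^ 2 ^ (s * t) = x} = Set.univ := by
    refine Set.eq_univ_of_forall fun x => ?_
    have hx := congrFun h x
    rw [Function.iterate_add_apply] at hx
    have hx := ((iterateFrobenius K 2 s).injective.iterate i) hx
    rw [iterateFrobenius_iterate] at hx
    exact hx.symm
  have h1 := ncard_pow_two_pow_eq_self hK (s * t)
  rw [huniv, Set.ncard_univ, hK] at h1
  rw [Nat.pow_right_injective le_rfl h1]
  exact Nat.gcd_dvd_left _ _

theorem numZeros_polyf [CharP K 2] (a : K) :
    numZeros (polyf k l a) =
      (twistedZeros (iterateFrobenius K 2 (k + l)) ((a ^ 2 ^ l) ^ 2)⁻¹).ncard := by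
  unfold numZeros twistedZeros
  congr 1
  ext y
  simp [polyf, iterateFrobenius_def, pow_succ']

/-- Here r^(2^k) = r⁻¹ explains the quotient a/r, and σ² is Frob^(2l) because Frob^(2k) = 1. -/
theorem numZeros_polyQ [Finite K] [CharP K 2] (hK : Nat.card K = 2 ^ (2 * k)) {r a : K}
    (hr : r ^ (2 ^ k + 1) = 1) (ha : a ^ 2 ^ k = a) :
    numZeros (polyQ k l r a) =
      (semilinearZeros (iterateFrobenius K 2 (k + l)) r a).ncard := by
  have hr0 : r ≠ 0 := by rintro rfl; simp at hr
  unfold numZeros semilinearZeros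
  congr 1
  ext x
  have h1 : iterateFrobenius K 2 (k + l) (a / r) = r ^ 2 ^ l * a ^ 2 ^ l := by
    have : (r ^ 2 ^ k)⁻¹ = r := by
      rw [pow_succ] at hr
      exact inv_eq_of_mul_eq_one_right hr
    rw [iterateFrobenius_def, div_pow, pow_add, pow_mul, pow_mul, ha, div_eq_mul_inv, mul_comm,
      ← inv_pow, this]
  have h2 : iterateFrobenius K 2 (k + l) (iterateFrobenius K 2 (k + l) x) = x ^ 2 ^ (2 * l) := by
    rw [iterateFrobenius_def, iterateFrobenius_def, ← pow_mul, ← pow_add,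
      show k + l + (k + l) = 2 * k * 1 + 2 * l by ring, pow_add, pow_mul,
      pow_two_pow_mul_card hK]
  rw [Set.mem_ofPred_eq, Set.mem_ofPred_eq, h1, h2]
  simp [polyQ, iterateFrobenius_def]

end

/-! ### Parity and gcd arithmetic. -/

theorem mainTheorem12 {F K : Type*} [Field F] [Field K] [Algebra F K]
    (k l : ℕ) (hl : 0 < l) (hlk : l < k)
    (hF : Nat.card F = 2 ^ k) (hK : Nat.card K = 2 ^ (2 * k))
    (r : K) (hr : r ^ (2 ^ k + 1) = 1) (a : F) (ha : a ≠ 0) :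
    (Even ((k + l) / Nat.gcd l k) →
      r ^ ((2 ^ k + 1) / (2 ^ Nat.gcd l k + 1)) = 1 →
      ExactlyOneOfThree
        (numZeros (polyf k l (algebraMap F K a)) = 1 ∧
          numZeros (polyQ k l r (algebraMap F K a)) = 2 ^ (2 * Nat.gcd l k))
        (numZeros (polyf k l (algebraMap F K a)) = 2 ∧
          numZeros (polyQ k l r (algebraMap F K a)) = 1)
        (numZeros (polyf k l (algebraMap F K a)) = 2 ^ (2 * Nat.gcd l k) + 1 ∧
          numZeros (polyQ k l r (algebraMap F K a)) = 2 ^ (4 * Nat.gcd l k))) ∧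
    (Odd ((k + l) / Nat.gcd l k) →
      Xor
        (numZeros (polyf k l (algebraMap F K a)) = 2 ^ Nat.gcd l k + 1 ∧
          numZeros (polyQ k l r (algebraMap F K a)) = 2 ^ (2 * Nat.gcd l k))
        ((numZeros (polyf k l (algebraMap F K a)) = 0 ∨
            numZeros (polyf k l (algebraMap F K a)) = 2) ∧
          numZeros (polyQ k l r (algebraMap F K a)) = 1)) := by
  have hk : 0 < k := hl.trans hlk
  have hcK : CharP K 2 := charP_two_of_card (by omega) hK
  have hfinK : Finite K := Nat.finite_of_card_ne_zero (by rw [hK]; positivity)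
  have hfinF : Finite F := Nat.finite_of_card_ne_zero (by rw [hF]; positivity)
  set α := algebraMap F K a with hα
  have hα0 : α ≠ 0 := (_root_.map_ne_zero _).2 ha
  have hαk : α ^ 2 ^ k = α := by
    have := Fintype.ofFinite F
    rw [hα, ← map_pow, ← hF, Nat.card_eq_fintype_card, FiniteField.pow_card]
  have hr0 : r ≠ 0 := by rintro rfl; simp at hr
  set σ := iterateFrobenius K 2 (k + l) with hσdef
  set τ := iterateFrobenius K 2 k with hτdef
  have hτα : τ α = α := hαk
  have hτ2 : ∀ x, τ (τ x) = x := fun x => by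
    rw [hτdef, iterateFrobenius_def, iterateFrobenius_def, ← pow_mul, ← pow_add, ← two_mul]
    simpa using pow_two_pow_mul_card hK 1 x
  have hσα : α ^ 2 ^ l = σ α := by
    rw [hσdef, iterateFrobenius_def, pow_add, pow_mul, hαk]
  have hfix := ncard_pow_two_pow_eq_self hK
  have hfixσ : {x : K | σ x = x}.ncard = 2 ^ (k + l).gcd (2 * k) := hfix (k + l)
  rw [numZeros_polyf, numZeros_polyQ hK hr hαk, hσα, ← hσdef]
  set d := l.gcd k with hd
  have hd0 : 0 < d := Nat.gcd_pos_of_pos_left _ hl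
  obtain ⟨l', hl'⟩ : d ∣ l := Nat.gcd_dvd_left l k
  obtain ⟨k', hk'⟩ : d ∣ k := Nat.gcd_dvd_right l k
  have hcop : l'.Coprime k' := by
    have h1 : d * l'.gcd k' = d * 1 := by rw [← Nat.gcd_mul_left, ← hl', ← hk', mul_one]
    exact Nat.eq_of_mul_eq_mul_left hd0 h1
  have hdiv : (k + l) / d = k' + l' := by
    rw [hl', hk', ← mul_add, Nat.mul_div_cancel_left _ hd0]
  have hcop2 : (k' + l').Coprime k' := by
    rwa [Nat.coprime_self_add_left]
  have hfact : ∀ i, 2 ^ (2 * i) - 1 = (2 ^ i - 1) * (2 ^ i + 1) := fun i => by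
    rw [mul_comm 2 i, pow_mul, mul_comm (2 ^ i - 1), ← Nat.sq_sub_sq, one_pow]
  have hminus : 2 ^ d - 1 ∣ 2 ^ k - 1 := by
    rw [hk', pow_mul]
    simpa using Nat.sub_dvd_pow_sub_pow (2 ^ d) 1 k'
  rw [hdiv]
  constructor
  · intro heven hr1
    have hkodd : Odd k' := by
      by_contra hk2
      have h2 : Even k' := Nat.not_odd_iff_even.1 hk2
      exact absurd (Nat.dvd_gcd heven.two_dvd h2.two_dvd) (by rw [hcop2]; norm_num)
    have hlodd : Odd l' := by
      by_contra hl2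
      have h2 : Even l' := Nat.not_odd_iff_even.1 hl2
      exact Nat.not_even_iff_odd.2 hkodd ((Nat.even_add.1 heven).2 h2)
    have hgcd : (k + l).gcd (2 * k) = 2 * d := by
      obtain ⟨e, he⟩ := heven.two_dvd
      have he' : e.Coprime k' := hcop2.coprime_dvd_left ⟨2, by rw [he, mul_comm]⟩
      rw [show k + l = 2 * d * e by rw [hl', hk', ← mul_add, he]; ring,
        show 2 * k = 2 * d * k' by rw [mul_assoc, ← hk'], Nat.gcd_mul_left, he', mul_one]
    rw [hgcd] at hfixσ
    have hplus : 2 ^ d + 1 ∣ 2 ^ k + 1 := by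
      have := hkodd.nat_add_dvd_pow_add_pow (2 ^ d) 1
      rwa [one_pow, ← pow_mul, ← hk'] at this
    have hcob : IsMulCoboundary σ r := by
      refine isMulCoboundary_iterateFrobenius hK hr0 hr1 ?_
      rw [hgcd, hfact k, hfact d, mul_assoc, Nat.mul_div_cancel' hplus]
      exact Nat.mul_dvd_mul_right hminus _
    have hcases := ncard_zeros_cases hα0 hr0 hcob hfixσ
    -- Otherwise the fixed field of σ, of order 2^(2d), would lie in that of Frob^l, of order 2^d
    -- because l' is odd.
    obtain ⟨θ, hσθ, hθ⟩ : ∃ θ, σ θ = θ ∧ τ θ ≠ θ := by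
      by_contra! hcon
      have hsub : {x : K | σ x = x} ⊆ {x : K | x ^ 2 ^ l = x} := by
        intro x hx
        have h1 : x ^ 2 ^ (k + l) = x := hx
        have h2 : x ^ 2 ^ k = x := hcon x hx
        rw [pow_add, pow_mul, h2] at h1
        exact h1
      have hle := Set.ncard_le_ncard hsub
      have hg : l.gcd (2 * k) = d := by
        have h2 : l'.Coprime (2 * k') := (Nat.coprime_two_right.2 hlodd).mul_right hcop
        rw [hl', show 2 * k = d * (2 * k') by rw [hk']; ring, Nat.gcd_mul_left, h2, mul_one]
      rw [hfixσ, hfix, hg, Nat.pow_le_pow_iff_right (by norm_num)] at hle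
      omega
    have hk0 : 0 < k' := Nat.pos_of_ne_zero fun h => by simp [h] at hkodd
    -- The order of σ is k': (k+l) k' is a multiple of 2k, and k' is prime to k' + l'.
    have hne := twistedZeros_nonempty (σ := σ) (τ := τ) (k := k) hk0
      (fun x => by
        obtain ⟨e, he⟩ := heven
        rw [hσdef, iterateFrobenius_iterate,
          show (k + l) * k' = 2 * k * e by rw [hl', hk', ← mul_add, he]; ring]
        exact pow_two_pow_mul_card hK e x)
      (by
        have hdvd : ∀ i t, σ^[i] = σ^[i + t] → k' ∣ t := by
          intro i t h
          have h1 := dvd_mul_of_iterate_iterateFrobenius_eq hK h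
          rw [show 2 * k = d * (2 * k') by rw [hk']; ring,
            show (k + l) * t = d * ((k' + l') * t) by rw [hl', hk']; ring] at h1
          exact hcop2.symm.dvd_of_dvd_mul_left
            (dvd_of_mul_left_dvd (Nat.dvd_of_mul_dvd_mul_left hd0 h1))
        intro i hi j hj hij
        rcases le_total i j with h | h <;> obtain ⟨t, rfl⟩ := Nat.exists_eq_add_of_le h
        · have := Nat.eq_zero_of_dvd_of_lt (hdvd i t hij) (by omega)
          omega
        · have := Nat.eq_zero_of_dvd_of_lt (hdvd j t hij.symm) (by omega)
          omega) hτ2 (fun x => by rw [hτdef, coe_iterateFrobenius]) hσθ hθ hα0 hτα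
    have hne0 := (Set.ncard_pos).2 hne
    have h4 : 2 ^ (4 * d) = (2 ^ (2 * d)) ^ 2 := by rw [← pow_mul]; ring_nf
    have hq : 2 ^ 2 ≤ 2 ^ (2 * d) := Nat.pow_le_pow_right (by norm_num) (by omega)
    rw [h4]
    rcases hcases with h | h | h | h
    · omega
    · exact Or.inl ⟨h, by omega, by omega⟩
    · exact Or.inr (Or.inl ⟨by omega, h, by omega⟩)
    · exact Or.inr (Or.inr ⟨by omega, by omega, h⟩)
  · intro hodd
    have hgcd : (k + l).gcd (2 * k) = d := by
      have h2 : (k' + l').Coprime (2 * k') := (Nat.coprime_two_right.2 hodd).mul_right hcop2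
      rw [show k + l = d * (k' + l') by rw [hl', hk', mul_add],
        show 2 * k = d * (2 * k') by rw [hk']; ring, Nat.gcd_mul_left, h2, mul_one]
    rw [hgcd] at hfixσ
    have hcob : IsMulCoboundary σ r := by
      refine isMulCoboundary_iterateFrobenius hK hr0 hr ?_
      rw [hgcd, hfact k]
      exact Nat.mul_dvd_mul_right hminus _
    have hcases := ncard_zeros_cases hα0 hr0 hcob hfixσ
    obtain ⟨θ, hθ⟩ : ∃ θ, τ θ ≠ θ := by
      by_contra! hcon
      have huniv : {x : K | x ^ 2 ^ k = x} = Set.univ := Set.eq_univ_of_forall hcon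
      have h1 := hfix k
      rw [huniv, Set.ncard_univ, hK, Nat.gcd_mul_left_right] at h1
      have := Nat.pow_right_injective le_rfl h1
      omega
    -- Here σ^k' = τ, since (k+l) k' = k (k' + l') is an odd multiple of k.
    have hne := ncard_twistedZeros_ne_one (σ := σ) (j := k') hτ2 (fun x => by
      obtain ⟨e, he⟩ := hodd
      rw [hσdef, iterateFrobenius_iterate,
        show (k + l) * k' = 2 * k * e + k by rw [hl', hk', ← mul_add, he]; ring, pow_add,
        pow_mul, pow_two_pow_mul_card hK, hτdef, iterateFrobenius_def]) hθ hα0 hτα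
    have h4 : 2 ^ (2 * d) = (2 ^ d) ^ 2 := by rw [← pow_mul, mul_comm]
    have hq : 2 ^ 1 ≤ 2 ^ d := Nat.pow_le_pow_right (by norm_num) hd0
    rw [h4]
    rcases hcases with h | h | h | h
    · exact Or.inr ⟨⟨Or.inl h.1, h.2⟩, by omega⟩
    · omega
    · exact Or.inr ⟨⟨Or.inr h.1, h.2⟩, by omega⟩
    · exact Or.inl ⟨h, by omega⟩
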